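/- Corollary 4.10 (DADS): Let $R$ be an associative ring with identity and $R\text{-Mod}$ the category of left $R$-modules. A submodule $N$ of a module $M$ is *essential* if it meets every nonzero submodule of $M$ nontrivially. Put $Z(M)=\{x\in M : Ix=0 \text{ for some essential left ideal } I \text{ of } R\}$; $M$ is *singular* if $Z(M)=M$, and $R$ is *left nonsingular* if $Z({}_RR)=0$. Let $E({}_RR)$ be the injective envelope of ${}_RR$. Suppose that $R$ is left nonsingular. Let $\mathcal X$ be the full subcategory of $\mathcal A:=R\text{-Mod}$ of all singular modules and $\mathcal Y$ the full subcategory of all direct summands of arbitrary products of copies of $E({}_RR)$. Then $(\mathcal X,\mathcal Y)$ is a derived decomposition of $\mathcal A$, that is: (D1) $\mathcal X$ and $\mathcal Y$ are abelian subcategories of $\mathcal A$ (abelian categories with exact inclusion, i.e. additive subcategories closed under kernels and cokernels in $\mathcal A$), and the inclusions induce fully faithful functors $\mathscr D^b(\mathcal X)\to\mathscr D^b(\mathcal A)$ and $\mathscr D^b(\mathcal Y)\to\mathscr D^b(\mathcal A)$ of bounded derived categories; (D2) $\operatorname{Hom}_{\mathscr D^b(\mathcal A)}(X,Y[n])=0$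 for all $X\in\mathcal X$, $Y\in\mathcal Y$ and $n\in\mathbb Z$; (D3) for every $M^\bullet\in\mathscr D^b(\mathcal A)$ there is a distinguished triangle $X_{M^\bullet}\to M^\bullet\to Y^{M^\bullet}\to X_{M^\bullet}[1]$ in $\mathscr D^b(\mathcal A)$ with $X_{M^\bullet}$ in the image of $\mathscr D^b(\mathcal X)$ and $Y^{M^\bullet}$ in the image of $\mathscr D^b(\mathcal Y)$. -/

import Mathlib

open CategoryTheory

universe u v

namespace SingularModules

section Modules

variable {R : Type u} [Ring R]

/-- A submodule `N` of `M` is essential if it meets every nonzero submodule nontrivially. -/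
def IsEssential {M : Type v} [AddCommGroup M] [Module R M] (N : Submodule R M) : Prop :=
  ∀ P : Submodule R M, P ≠ ⊥ → N ⊓ P ≠ ⊥

theorem isEssential_iff {M : Type v} [AddCommGroup M] [Module R M] (N : Submodule R M) :
    IsEssential N ↔ ∀ x : M, x ≠ 0 → ∃ r : R, r • x ∈ N ∧ r • x ≠ 0 := by
  constructor
  · intro h x hx
    have h1 := h (R ∙ x) (by simpa using hx)
    obtain ⟨y, hy, hy0⟩ := Submodule.exists_mem_ne_zero_of_ne_bot h1
    obtain ⟨r, rfl⟩ := Submodule.mem_span_singleton.1 hy.2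
    exact ⟨r, hy.1, hy0⟩
  · intro h P hP hbot
    obtain ⟨x, hx, hx0⟩ := Submodule.exists_mem_ne_zero_of_ne_bot hP
    obtain ⟨r, hr, hr0⟩ := h x hx0
    have : r • x ∈ N ⊓ P := ⟨hr, P.smul_mem r hx⟩
    rw [hbot] at this
    exact hr0 (by simpa using this)

/-- The singular submodule `Z(M)`: the elements annihilated by an essential left ideal. -/
def singularSubmodule (R : Type u) [Ring R] (M : Type v) [AddCommGroup M] [Module R M] :
    Submodule R M where
  carrier := {x | ∃ I : Submodule R R, IsEssential I ∧ ∀ r ∈ I, r • x = 0}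
  zero_mem' := ⟨⊤, fun P hP => by simpa using hP, fun r _ => smul_zero r⟩
  add_mem' := by
    rintro x y ⟨I, hI, hIx⟩ ⟨J, hJ, hJy⟩
    refine ⟨I ⊓ J, fun P hP => ?_, fun r hr => ?_⟩
    · rw [inf_assoc]
      exact hI _ (hJ P hP)
    · rw [smul_add, hIx r hr.1, hJy r hr.2, add_zero]
  smul_mem' := by
    rintro a x ⟨I, hI, hIx⟩
    refine ⟨I.comap (LinearMap.toSpanSingleton R R a), ?_, fun r hr => ?_⟩
    · rw [isEssential_iff] at hI ⊢
      intro s hs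
      by_cases h : s * a = 0
      · exact ⟨1, by simp [h], by simpa using hs⟩
      · obtain ⟨r, hr, hr0⟩ := hI (s * a) h
        refine ⟨r, by simpa [mul_assoc] using hr, fun h0 => hr0 ?_⟩
        simp only [smul_eq_mul] at h0 ⊢
        rw [← mul_assoc, h0, zero_mul]
    · rw [smul_smul]
      exact hIx _ (by simpa using hr)

/-- `M` is singular if `Z(M) = M`. -/
def IsSingular (R : Type u) [Ring R] (M : Type v) [AddCommGroup M] [Module R M] : Prop :=
  singularSubmodule R M = ⊤

/-- `M` is nonsingular if `Z(M) = 0`. -/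
def IsNonsingular (R : Type u) [Ring R] (M : Type v) [AddCommGroup M] [Module R M] : Prop :=
  singularSubmodule R M = ⊥

/-- `R` is left nonsingular if the left regular module is nonsingular. -/
def IsLeftNonsingularRing (R : Type u) [Ring R] : Prop := IsNonsingular R R

/-- `f : M → E` exhibits `E` as an injective envelope of `M`: `E` is an injective module and an
essential extension of the image of `M`. -/
structure IsInjectiveEnvelope {M E : Type u} [AddCommGroup M] [Module R M]
    [AddCommGroup E] [Module R E] (f : M →ₗ[R] E) : Prop where
  injective_map : Function.Injective f
  essential_range : IsEssential (LinearMap.range f)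
  injective_module : Module.Injective R E

/-- Every module has an injective envelope: a maximal essential extension inside an injective
module. -/
theorem exists_isInjectiveEnvelope (M : Type u) [AddCommGroup M] [Module R M] :
    ∃ (E : ModuleCat.{u} R) (f : M →ₗ[R] E), IsInjectiveEnvelope f := by
  let J : ModuleCat.{u} R := Injective.under (ModuleCat.of R M)
  let i : M →ₗ[R] J := (Injective.ι (ModuleCat.of R M)).hom
  have hi : Function.Injective i :=
    (ModuleCat.mono_iff_injective (Injective.ι (ModuleCat.of R M))).1 inferInstance
  have hJ : Module.Injective R J := (Module.injective_iff_injective_object R J).2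
    (inferInstanceAs (Injective (Injective.under (ModuleCat.of R M))))
  let A := LinearMap.range i
  obtain ⟨E, hAE, hE⟩ := zorn_le_nonempty₀
    {E : Submodule R J | ∀ x ∈ E, x ≠ 0 → ∃ r : R, r • x ∈ A ∧ r • x ≠ 0}
    (fun c hc hchain y hy => ⟨sSup c, fun x hx hx0 => by
      obtain ⟨F, hF, hxF⟩ :=
        (Submodule.mem_sSup_of_directed ⟨y, hy⟩ hchain.directedOn).1 hx
      exact hc hF x hxF hx0, fun z hz => le_sSup hz⟩)
    A (fun x hx hx0 => ⟨1, by simpa using hx, by simpa using hx0⟩)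
  obtain ⟨N, -, hN⟩ := zorn_le_nonempty₀
    {N : Submodule R J | Disjoint E N}
    (fun c hc hchain y hy => ⟨sSup c, by
      refine Submodule.disjoint_def.2 ?_
      intro x hxE hx
      obtain ⟨F, hF, hxF⟩ :=
        (Submodule.mem_sSup_of_directed ⟨y, hy⟩ hchain.directedOn).1 hx
      exact Submodule.disjoint_def.1 (hc hF) x hxE hxF, fun z hz => le_sSup hz⟩)
    ⊥ disjoint_bot_right
  have hdis : Disjoint E N := hN.prop
  obtain ⟨g, hg⟩ := hJ.out (N.mkQ ∘ₗ E.subtype) (by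
    rw [← LinearMap.ker_eq_bot, LinearMap.ker_eq_bot']
    intro x hx
    have : (x : J) ∈ N := by simpa using hx
    exact Subtype.ext (Submodule.disjoint_def.1 hdis _ x.2 this)) E.subtype
  let h : J →ₗ[R] J := g ∘ₗ N.mkQ
  have hid : ∀ x ∈ E, h x = x := fun x hx => hg ⟨x, hx⟩
  have hker : ∀ x ∈ N, h x = 0 := fun x hx => by
    have h0 : N.mkQ x = 0 := (Submodule.Quotient.mk_eq_zero N).2 hx
    change g (N.mkQ x) = 0
    rw [h0, map_zero]
  have hrange : ∀ x, h x ∈ E := by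
    have hle : E ≤ LinearMap.range h := fun x hx => ⟨x, hid x hx⟩
    have := hE.le_of_ge (y := LinearMap.range h) (by
      rintro _ ⟨x, rfl⟩ hx0
      have hxN : x ∉ N := fun hx => hx0 (hker x hx)
      have hnd : ¬ Disjoint E (N ⊔ R ∙ x) := fun hd => hxN
        (hN.le_of_ge hd le_sup_left (le_sup_right (a := N) (Submodule.mem_span_singleton_self x)))
      rw [Submodule.disjoint_def] at hnd
      push Not at hnd
      obtain ⟨e, heE, he, he0⟩ := hnd
      obtain ⟨n, hn, z, hz, rfl⟩ := Submodule.mem_sup.1 he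
      obtain ⟨r, rfl⟩ := Submodule.mem_span_singleton.1 hz
      have h1 : r • h x = n + r • x := by
        rw [← hid _ heE, map_add, hker n hn, zero_add, map_smul]
      obtain ⟨s, hs, hs0⟩ := hE.prop _ heE he0
      exact ⟨s * r, by rwa [mul_smul, h1], by rwa [mul_smul, h1]⟩) hle
    exact fun x => this ⟨x, rfl⟩
  have hiE : ∀ x, i x ∈ E := fun x => hAE ⟨x, rfl⟩
  refine ⟨ModuleCat.of R E, i.codRestrict E hiE, ?_, ?_, ?_⟩
  · intro x y hxy
    exact hi (congrArg Subtype.val hxy)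
  · rw [isEssential_iff]
    rintro ⟨x, hx⟩ hx0
    obtain ⟨r, ⟨m, hm⟩, hr0⟩ := hE.prop x hx (fun h0 => hx0 (Subtype.ext h0))
    exact ⟨r, ⟨m, Subtype.ext hm⟩, fun h0 => hr0 (congrArg Subtype.val h0)⟩
  · constructor
    intro X Y _ _ _ _ f hf q
    obtain ⟨k, hk⟩ := hJ.out f hf (E.subtype ∘ₗ q)
    refine ⟨(h.codRestrict E hrange) ∘ₗ k, fun x => Subtype.ext ?_⟩
    change h (k (f x)) = q x
    rw [hk]
    exact hid _ (q x).2

/-- The injective envelope `E(M)` of an `R`-module `M`. -/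
noncomputable def injectiveEnvelope (R : Type u) [Ring R] (M : Type u) [AddCommGroup M]
    [Module R M] : ModuleCat.{u} R :=
  (exists_isInjectiveEnvelope (R := R) M).choose

/-- The embedding of `M` in its injective envelope. -/
noncomputable def toInjectiveEnvelope (R : Type u) [Ring R] (M : Type u) [AddCommGroup M]
    [Module R M] : M →ₗ[R] injectiveEnvelope R M :=
  (exists_isInjectiveEnvelope (R := R) M).choose_spec.choose

theorem isInjectiveEnvelope_toInjectiveEnvelope (R : Type u) [Ring R] (M : Type u)
    [AddCommGroup M] [Module R M] : IsInjectiveEnvelope (toInjectiveEnvelope R M) :=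
  (exists_isInjectiveEnvelope (R := R) M).choose_spec.choose_spec

/-- The full subcategory of singular modules in `R`-Mod. -/
def singularModules (R : Type u) [Ring R] : ObjectProperty (ModuleCat.{u} R) :=
  fun M => IsSingular R M

/-- The full subcategory of `R`-Mod of all direct summands of arbitrary products of copies
of `E`. -/
def summandsOfPowers {R : Type u} [Ring R] (E : ModuleCat.{u} R) :
    ObjectProperty (ModuleCat.{u} R) :=
  fun M => ∃ (I : Type u) (N : ModuleCat.{u} R), Nonempty ((M × N) ≃ₗ[R] (I → E))

end Modules

end SingularModules

namespace DerivedDecomposition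

open Limits Pretriangulated DerivedCategory DerivedCategory.TStructure

section Subcategories

variable {A : Type u} [Category.{v} A] [Abelian A]

/-- A full subcategory of an abelian category `A` is an abelian subcategory if it is an additive
subcategory closed under kernels and cokernels in `A`; equivalently, it is an abelian category
and the inclusion is exact. -/
class IsAbelianSubcategory (P : ObjectProperty A) : Prop extends
    P.ContainsZero, P.IsClosedUnderFiniteProducts,
    P.IsClosedUnderKernels, P.IsClosedUnderCokernels

variable (P : ObjectProperty A) [IsAbelianSubcategory P]

instance : PreservesFiniteLimits P.ι := by
  have := P.preservesKernels_ι
  exact P.ι.preservesFiniteLimits_of_preservesKernels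

instance : PreservesFiniteColimits P.ι := by
  have := P.preservesCokernels_ι
  exact P.ι.preservesFiniteColimits_of_preservesCokernels

end Subcategories

section Bounded

attribute [local instance] HasDerivedCategory.standard

/-- The bounded derived category of `A`: the full subcategory of the derived category of `A`
on the complexes with finitely many nonzero cohomologies. -/
abbrev Db (A : Type u) [Category.{v} A] [Abelian A] : Type (max u v) :=
  DerivedCategory.Bounded A

/-- The canonical functor from `A` to its bounded derived category, sending an object to the
complex concentrated in degree `0`. -/
noncomputable def stalk (A : Type u) [Category.{v} A] [Abelian A] : A ⥤ Db A :=
  (t (C := A)).bounded.lift (singleFunctor A 0)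
    (fun X => ⟨⟨0, inferInstanceAs (((singleFunctor A 0).obj X).IsGE 0)⟩,
      ⟨0, inferInstanceAs (((singleFunctor A 0).obj X).IsLE 0)⟩⟩)

universe u' v'

variable {B : Type u'} [Category.{v'} B] [Abelian B] {A : Type u} [Category.{v} A] [Abelian A]

theorem bounded_mapDerivedCategory_obj (F : B ⥤ A) [F.Additive] [PreservesFiniteLimits F]
    [PreservesFiniteColimits F] (X : DerivedCategory B) (hX : (t (C := B)).bounded X) :
    (t (C := A)).bounded (F.mapDerivedCategory.obj X) := by
  obtain ⟨⟨a, ha⟩, ⟨b, hb⟩⟩ := hX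
  obtain ⟨K, hKa, hKb, ⟨e⟩⟩ := exists_iso_Q_obj_of_isGE_of_isLE X a b
  let e' : F.mapDerivedCategory.obj X ≅
      Q.obj ((F.mapHomologicalComplex (ComplexShape.up ℤ)).obj K) :=
    F.mapDerivedCategory.mapIso e ≪≫ F.mapDerivedCategoryFactors.app K
  exact ⟨⟨a, ⟨_, e', inferInstance⟩⟩, ⟨b, ⟨_, e', inferInstance⟩⟩⟩

/-- The functor induced on bounded derived categories by an exact functor, applying the functor
to complexes degreewise. -/
noncomputable def mapDb (F : B ⥤ A) [F.Additive] [PreservesFiniteLimits F]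
    [PreservesFiniteColimits F] : Db B ⥤ Db A :=
  (t (C := A)).bounded.lift ((t (C := B)).bounded.ι ⋙ F.mapDerivedCategory)
    (fun X => bounded_mapDerivedCategory_obj F X.obj X.property)

/-- The pair `(X, Y)` of full subcategories of the abelian category `A` is a derived
decomposition of `A`: both are abelian subcategories, the inclusions induce fully faithful
functors on bounded derived categories, `Hom(M, N[n])` vanishes in the bounded derived category
of `A` for `M` in `X`, `N` in `Y` and every integer `n`, and each object of the bounded derived
category of `A` lies in a distinguished triangle between the images of those of `X` and `Y`. -/
structure IsDerivedDecomposition (X Y : ObjectProperty A) : Prop where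
  isAbelianSubcategory_left : IsAbelianSubcategory X
  isAbelianSubcategory_right : IsAbelianSubcategory Y
  full_left : (mapDb X.ι).Full
  faithful_left : (mapDb X.ι).Faithful
  full_right : (mapDb Y.ι).Full
  faithful_right : (mapDb Y.ι).Faithful
  hom_eq_zero : ∀ (M N : A), X M → Y N → ∀ (n : ℤ)
    (f : (stalk A).obj M ⟶ ((stalk A).obj N)⟦n⟧), f = 0
  exists_triangle : ∀ M : Db A, ∃ (K : Db X.FullSubcategory) (L : Db Y.FullSubcategory)
    (f : (mapDb X.ι).obj K ⟶ M) (g : M ⟶ (mapDb Y.ι).obj L)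
    (h : (mapDb Y.ι).obj L ⟶ ((mapDb X.ι).obj K)⟦(1 : ℤ)⟧),
    Triangle.mk f g h ∈ distTriang (Db A)

end Bounded

end DerivedDecomposition

namespace DerivedDecomposition

open Limits Pretriangulated DerivedCategory DerivedCategory.TStructure

/-! Left nonsingularity has two effects. First, `summandsOfPowers_iff` identifies $\mathcal Y$ with
the nonsingular injective modules. Second, an element moved into $Z(M)$ by an essential left ideal
already lies in $Z(M)$ (`mem_singularSubmodule_of_smul_mem`), so $M/Z(M)$ is nonsingular and
injective envelopes of singular modules are singular.

Hence each subcategory has enough injectives, and they remain injective in $\mathcal A$. A bounded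
below injective resolution formed in the subcategory is then K-injective both there and in $\mathcal
A$. Morphisms into it are homotopy classes of chain maps on both sides, which gives full
faithfulness. Orthogonality is similar: every $N\in\mathcal Y$ is injective, so its stalk is
K-injective, and a singular module has no nonzero map to a nonsingular one.

For the triangles, maps from $M$ to nonsingular injectives extend uniquely along $M\to
L(M)=E(M/Z(M))$, so $L$ is an additive functor. This map has kernel $Z(M)$, and its cokernel is a
quotient by an essential submodule, so both are singular. Applied degreewise to a bounded complex
$K$, it gives $K\to LK$ with $LK$ in $\mathcal Y$ and with kernel and cokernel complexes in
$\mathcal X$; its cone therefore comes from $\mathscr D^b(\mathcal X)$. Exactness of $L$ is not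
needed. -/

theorem map_bijective_of_iso {C D : Type*} [Category* C] [Category* D] (F : C ⥤ D)
    {X X' Y Y' : C} (e : X ≅ X') (e' : Y ≅ Y')
    (h : Function.Bijective (F.map : (X ⟶ Y) → _)) :
    Function.Bijective (F.map : (X' ⟶ Y') → _) := by
  rw [← Function.Bijective.of_comp_iff _ (Iso.homCongr e e').bijective]
  convert (Iso.homCongr (F.mapIso e) (F.mapIso e')).bijective.comp h using 1
  ext f
  simp [Iso.homCongr]

theorem map_bijective_of_natIso {C D : Type*} [Category* C] [Category* D] {F G : C ⥤ D}
    (e : F ≅ G) {X Y : C} (h : Function.Bijective (F.map : (X ⟶ Y) → _)) :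
    Function.Bijective (G.map : (X ⟶ Y) → _) := by
  convert (Iso.homCongr (e.app X) (e.app Y)).bijective.comp h using 1
  ext f
  simp [Iso.homCongr]

/-! ### Full faithfulness on derived categories -/

section FullyFaithful

attribute [local instance] HasDerivedCategory.standard

universe u' v'

variable {B : Type u'} [Category.{v'} B] [Abelian B] {A : Type u} [Category.{v} A] [Abelian A]

/-- A bounded below complex of injective objects is sent to a K-injective complex by a functor
preserving injective objects. -/
theorem isKInjective_mapHomologicalComplex (F : B ⥤ A) [F.Additive]
    [F.PreservesInjectiveObjects]
    (L : CochainComplex B ℤ) (n : ℤ) [L.IsStrictlyGE n] [∀ i, Injective (L.X i)] :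
    CochainComplex.IsKInjective ((F.mapHomologicalComplex (ComplexShape.up ℤ)).obj L) := by
  have : ∀ i, Injective (((F.mapHomologicalComplex (ComplexShape.up ℤ)).obj L).X i) :=
    fun i => F.injective_obj_of_injective inferInstance
  have : CochainComplex.IsStrictlyGE
    ((F.mapHomologicalComplex (ComplexShape.up ℤ)).obj L) n := inferInstance
  exact CochainComplex.isKInjective_of_injective _ n

variable (F : B ⥤ A) [F.Additive] [PreservesFiniteLimits F] [PreservesFiniteColimits F]

/-- An exact fully faithful functor induces bijections on those morphisms of derived categories
whose target is K-injective in both categories. -/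
theorem mapDerivedCategory_map_bijective [F.Full] [F.Faithful]
    (K L : CochainComplex B ℤ) [L.IsKInjective]
    [CochainComplex.IsKInjective ((F.mapHomologicalComplex (ComplexShape.up ℤ)).obj L)] :
    Function.Bijective (F.mapDerivedCategory.map : (Q.obj K ⟶ Q.obj L) → _) := by
  let q := HomotopyCategory.quotient B (ComplexShape.up ℤ)
  have h1 : Function.Bijective (Qh.map : (q.obj K ⟶ q.obj L) → _) :=
    CochainComplex.IsKInjective.Qh_map_bijective _ _
  have h2 : Function.Bijective
      ((F.mapHomotopyCategory (ComplexShape.up ℤ) ⋙ Qh).map : (q.obj K ⟶ q.obj L) → _) :=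
    (CochainComplex.IsKInjective.Qh_map_bijective _
      ((F.mapHomologicalComplex (ComplexShape.up ℤ)).obj L)).comp
      ((Functor.FullyFaithful.ofFullyFaithful
        (F.mapHomotopyCategory (ComplexShape.up ℤ))).map_bijective (q.obj K) (q.obj L))
  have h3 : Function.Bijective
      ((Qh ⋙ F.mapDerivedCategory).map : (q.obj K ⟶ q.obj L) → _) :=
    map_bijective_of_natIso F.mapDerivedCategoryFactorsh.symm h2
  exact map_bijective_of_iso F.mapDerivedCategory ((quotientCompQhIso B).app K)
    ((quotientCompQhIso B).app L) ((Function.Bijective.of_comp_iff _ h1).1 h3)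

/-- Replace the target by a bounded below injective resolution in `B`. Since `F` preserves
injectives, it is K-injective on both sides; the source may be arbitrary. -/
theorem mapDerivedCategory_map_bijective_of_isGE [EnoughInjectives B]
    [F.PreservesInjectiveObjects] [F.Full] [F.Faithful] (X Y : DerivedCategory B) (n : ℤ)
    [Y.IsGE n] : Function.Bijective (F.mapDerivedCategory.map : (X ⟶ Y) → _) := by
  obtain ⟨K, ⟨eK⟩⟩ : ∃ K, Nonempty (Q.obj K ≅ X) := ⟨_, ⟨Q.objObjPreimageIso X⟩⟩
  obtain ⟨M, _, ⟨e⟩⟩ := exists_iso_Q_obj_of_isGE Y n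
  obtain ⟨L, i, _, _, _⟩ := CochainComplex.Plus.modelCategoryQuillen.exists_quasiIso_injective M n
  have := isKInjective_mapHomologicalComplex F L n
  have := CochainComplex.isKInjective_of_injective L n
  exact map_bijective_of_iso _ eK ((asIso (Q.map i)).symm ≪≫ e.symm)
    (mapDerivedCategory_map_bijective F K L)

section

variable [EnoughInjectives B] [F.PreservesInjectiveObjects] [F.Full] [F.Faithful]

theorem mapDb_map_bijective (X Y : Db B) :
    Function.Bijective ((mapDb F).map : (X ⟶ Y) → _) := by
  obtain ⟨n, hn⟩ := Y.property.1
  have h : Function.Bijective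
      (((t (C := B)).bounded.ι ⋙ F.mapDerivedCategory).map : (X ⟶ Y) → _) :=
    (mapDerivedCategory_map_bijective_of_isGE F X.obj Y.obj n).comp
      ((t (C := B)).bounded.fullyFaithfulι.map_bijective X Y)
  have h' : Function.Bijective ((mapDb F ⋙ (t (C := A)).bounded.ι).map : (X ⟶ Y) → _) :=
    map_bijective_of_natIso (ObjectProperty.liftCompιIso _ _ _).symm h
  exact (Function.Bijective.of_comp_iff' ((t (C := A)).bounded.fullyFaithfulι.map_bijective _ _)
    _).1 h'

theorem mapDb_full : (mapDb F).Full where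
  map_surjective := (mapDb_map_bijective F _ _).2

theorem mapDb_faithful : (mapDb F).Faithful where
  map_injective h := (mapDb_map_bijective F _ _).1 h

end

noncomputable instance : (mapDb F).CommShift ℤ := by
  dsimp only [mapDb]
  infer_instance

instance : (mapDb F).IsTriangulated := by
  dsimp only [mapDb]
  infer_instance

end FullyFaithful

/-! ### Injective objects of a full subcategory -/

section Subcategory

variable {A : Type u} [Category.{v} A] [Abelian A]
variable (P : ObjectProperty A) [IsAbelianSubcategory P]

theorem enoughInjectives_fullSubcategory
    (hP : ∀ X, P X → ∃ (J : A) (i : X ⟶ J), P J ∧ Injective J ∧ Mono i) :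
    EnoughInjectives P.FullSubcategory where
  presentation X := by
    obtain ⟨J, i, hJ, hJ', hi⟩ := hP X.obj X.property
    refine ⟨⟨⟨J, hJ⟩, P.ι.injective_of_map_injective hJ', ObjectProperty.homMk i, ?_⟩⟩
    exact P.ι.mono_of_mono_map hi

/-- An injective of `P` embeds in an ambient injective lying in `P`, and splits off it by its own
injectivity. -/
theorem preservesInjectiveObjects_ι
    (hP : ∀ X, P X → ∃ (J : A) (i : X ⟶ J), P J ∧ Injective J ∧ Mono i) :
    P.ι.PreservesInjectiveObjects where
  injective_obj {X} hX := by
    obtain ⟨J, i, hJ, hJ', hi⟩ := hP X.obj X.property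
    let i' : X ⟶ ⟨J, hJ⟩ := ObjectProperty.homMk i
    have : Mono i' := P.ι.mono_of_mono_map hi
    exact Retract.injective
      ((Retract.mk i' (Injective.factorThru (𝟙 X) i') (by simp)).map P.ι) (i := hJ')

end Subcategory

end DerivedDecomposition

namespace DerivedDecomposition

open Limits Pretriangulated DerivedCategory DerivedCategory.TStructure

theorem distinguished_of_iso_obj₁ {C : Type*} [Category* C] [HasZeroObject C] [HasShift C ℤ]
    [Preadditive C] [∀ n : ℤ, (shiftFunctor C n).Additive] [Pretriangulated C] {X X' Y Z : C}
    {f : X ⟶ Y} {g : Y ⟶ Z} {h : Z ⟶ X⟦(1 : ℤ)⟧} (hT : Triangle.mk f g h ∈ distTriang C)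
    (e : X' ≅ X) : Triangle.mk (e.hom ≫ f) g (h ≫ e.inv⟦(1 : ℤ)⟧') ∈ distTriang C := by
  refine isomorphic_distinguished _ hT _ (Triangle.isoMk _ _ e (Iso.refl _) (Iso.refl _) ?_ ?_ ?_)
  · exact Category.comp_id _
  · exact (Category.comp_id _).trans (Category.id_comp _).symm
  · change (h ≫ e.inv⟦(1 : ℤ)⟧') ≫ e.hom⟦(1 : ℤ)⟧' = 𝟙 _ ≫ h
    rw [Category.assoc, ← Functor.map_comp, e.inv_hom_id,
      CategoryTheory.Functor.map_id, Category.comp_id, Category.id_comp]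

/-! ### Vanishing of morphisms between stalk complexes -/

section Orthogonality

attribute [local instance] HasDerivedCategory.standard

variable {A : Type u} [Category.{v} A] [Abelian A]

/-- Morphisms into a K-injective complex in the derived category are homotopy classes, hence
represented by chain maps. -/
theorem Q_hom_eq_zero (K L : CochainComplex A ℤ) [L.IsKInjective] (h : ∀ f : K ⟶ L, f = 0)
    (f : Q.obj K ⟶ Q.obj L) : f = 0 := by
  have hs : Subsingleton (K ⟶ L) := ⟨fun a b => (h a).trans (h b).symm⟩
  have hq : Subsingleton ((HomotopyCategory.quotient A (ComplexShape.up ℤ)).obj K ⟶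
      (HomotopyCategory.quotient A (ComplexShape.up ℤ)).obj L) :=
    (HomotopyCategory.quotient A (ComplexShape.up ℤ)).map_surjective.subsingleton
  have hQ : Subsingleton ((HomotopyCategory.quotient A (ComplexShape.up ℤ) ⋙ Qh).obj K ⟶
      (HomotopyCategory.quotient A (ComplexShape.up ℤ) ⋙ Qh).obj L) :=
    (CochainComplex.IsKInjective.Qh_map_bijective _ _).2.subsingleton
  have : Subsingleton (Q.obj K ⟶ Q.obj L) :=
    (Iso.homCongr ((quotientCompQhIso A).app K) ((quotientCompQhIso A).app L)).symm.subsingleton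
  exact Subsingleton.elim _ _

theorem single_hom_shift_single_eq_zero (M N : A) (h : ∀ f : M ⟶ N, f = 0) (n : ℤ)
    (f : (HomologicalComplex.single A (ComplexShape.up ℤ) 0).obj M ⟶
      ((HomologicalComplex.single A (ComplexShape.up ℤ) 0).obj N)⟦n⟧) : f = 0 := by
  apply HomologicalComplex.from_single_hom_ext
  rw [HomologicalComplex.zero_f]
  by_cases hn : n = 0
  · subst hn
    have hs : Subsingleton (M ⟶ N) := ⟨fun a b => (h a).trans (h b).symm⟩
    exact (Iso.homCongr (HomologicalComplex.singleObjXSelf (ComplexShape.up ℤ) 0 M)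
      (HomologicalComplex.singleObjXSelf (ComplexShape.up ℤ) 0 N)).subsingleton.elim _ _
  · exact (HomologicalComplex.isZero_single_obj_X (ComplexShape.up ℤ) 0 N (0 + n)
      (by simpa using hn)).eq_of_tgt _ _

theorem stalk_hom_shift_eq_zero (M N : A) [Injective N] (h : ∀ f : M ⟶ N, f = 0) (n : ℤ)
    (f : (stalk A).obj M ⟶ ((stalk A).obj N)⟦n⟧) : f = 0 := by
  let s := HomologicalComplex.single A (ComplexShape.up ℤ) 0
  have hinj : ∀ i, Injective ((s.obj N).X i) := fun i => by
    by_cases hi : i = 0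
    · subst hi
      exact Injective.of_iso (HomologicalComplex.singleObjXSelf (ComplexShape.up ℤ) 0 N).symm
        inferInstance
    · have := (HomologicalComplex.isZero_single_obj_X (ComplexShape.up ℤ) 0 N i hi)
      exact Injective.of_iso ((isZero_zero A).iso this) inferInstance
  have hGE : CochainComplex.IsStrictlyGE (s.obj N) 0 := inferInstance
  have hK : CochainComplex.IsKInjective (s.obj N) :=
    CochainComplex.isKInjective_of_injective (s.obj N) 0
  let eM : ((stalk A).obj M).obj ≅ Q.obj (s.obj M) := (singleFunctorIsoCompQ A 0).app M
  let eN : ((stalk A).obj N).obj ≅ Q.obj (s.obj N) := (singleFunctorIsoCompQ A 0).app N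
  let e : (((stalk A).obj N)⟦n⟧).obj ≅ Q.obj ((s.obj N)⟦n⟧) :=
    ((t (C := A)).bounded.ι.commShiftIso n).app ((stalk A).obj N) ≪≫
      (shiftFunctor _ n).mapIso eN ≪≫ ((Q (C := A)).commShiftIso n).symm.app (s.obj N)
  apply (t (C := A)).bounded.ι.map_injective
  rw [Functor.map_zero, ← cancel_epi eM.inv, ← cancel_mono e.hom]
  rw [comp_zero, zero_comp]
  exact Q_hom_eq_zero _ _ (single_hom_shift_single_eq_zero M N h n) _

end Orthogonality

/-! ### Triangles from a functorial reflection -/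

section Triangles

attribute [local instance] HasDerivedCategory.standard

variable {A : Type u} [Category.{v} A] [Abelian A]

/-- A strictly bounded complex of objects of `P` comes from the bounded derived category of
`P`. -/
theorem exists_mapDb_iso (P : ObjectProperty A) [IsAbelianSubcategory P]
    (K : CochainComplex A ℤ) (a b : ℤ) [K.IsStrictlyGE a] [K.IsStrictlyLE b]
    (hK : ∀ n, P (K.X n)) :
    ∃ L : Db P.FullSubcategory, Nonempty (((mapDb P.ι).obj L).obj ≅ Q.obj K) := by
  let K' : CochainComplex P.FullSubcategory ℤ := HomologicalComplex.liftObjectProperty P K hK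
  have : K'.IsStrictlyGE a := by
    rwa [← CochainComplex.isStrictlyGE_mapHomologicalComplex_obj_iff _ P.ι]
  have : K'.IsStrictlyLE b := by
    rwa [← CochainComplex.isStrictlyLE_mapHomologicalComplex_obj_iff _ P.ι]
  exact ⟨⟨Q.obj K', ⟨a, inferInstance⟩, ⟨b, inferInstance⟩⟩,
    ⟨P.ι.mapDerivedCategoryFactors.app K'⟩⟩

theorem isClosedUnderIsomorphisms_of_isClosedUnderKernels (P : ObjectProperty A)
    [P.IsClosedUnderKernels] : P.IsClosedUnderIsomorphisms where
  of_iso {M N} e hM := by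
    -- An object isomorphic to `M` is a kernel of the zero endomorphism of `M`.
    have hl : IsLimit (KernelFork.ofι (f := (0 : M ⟶ M)) e.inv comp_zero) :=
      KernelFork.IsLimit.ofι _ _ (fun g _ => g ≫ e.hom) (by simp) (fun g _ m hm => by simp [← hm])
    exact P.prop_of_isLimit_kernelFork hl hM hM

theorem isStrictlyGE_of_mono {K L : CochainComplex A ℤ} (f : K ⟶ L) [Mono f] (n : ℤ)
    [L.IsStrictlyGE n] : K.IsStrictlyGE n := by
  rw [CochainComplex.isStrictlyGE_iff]
  exact fun i hi => (L.isZero_of_isStrictlyGE n i hi).of_mono (f.f i)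

theorem isStrictlyLE_of_mono {K L : CochainComplex A ℤ} (f : K ⟶ L) [Mono f] (n : ℤ)
    [L.IsStrictlyLE n] : K.IsStrictlyLE n := by
  rw [CochainComplex.isStrictlyLE_iff]
  exact fun i hi => (L.isZero_of_isStrictlyLE n i hi).of_mono (f.f i)

theorem isStrictlyGE_of_epi {K L : CochainComplex A ℤ} (f : K ⟶ L) [Epi f] (n : ℤ)
    [K.IsStrictlyGE n] : L.IsStrictlyGE n := by
  rw [CochainComplex.isStrictlyGE_iff]
  exact fun i hi => (K.isZero_of_isStrictlyGE n i hi).of_epi (f.f i)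

theorem isStrictlyLE_of_epi {K L : CochainComplex A ℤ} (f : K ⟶ L) [Epi f] (n : ℤ)
    [K.IsStrictlyLE n] : L.IsStrictlyLE n := by
  rw [CochainComplex.isStrictlyLE_iff]
  exact fun i hi => (K.isZero_of_isStrictlyLE n i hi).of_epi (f.f i)

/-- If the kernel and the cokernel of a morphism of complexes lie in a triangulated subcategory
of the derived category, then so does its cone. -/
theorem trW_Q_map (P : ObjectProperty (DerivedCategory A)) [P.IsTriangulated]
    {K L : CochainComplex A ℤ} (φ : K ⟶ L) (hker : P (Q.obj (kernel φ)))
    (hcoker : P (Q.obj (cokernel φ))) : P.trW (Q.map φ) := by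
  have h₁ : (ShortComplex.mk (kernel.ι φ) (cokernel.π (kernel.ι φ)) (by simp)).ShortExact :=
    { exact := ShortComplex.exact_cokernel _ }
  have h₂ : (ShortComplex.mk (kernel.ι (cokernel.π φ)) (cokernel.π φ) (by simp)).ShortExact :=
    { exact := ShortComplex.exact_kernel _ }
  have w₁ : P.trW (Q.map (cokernel.π (kernel.ι φ))) :=
    ObjectProperty.trW.mk' P (triangleOfSES_distinguished h₁) hker
  have w₂ : P.trW (Q.map (kernel.ι (cokernel.π φ))) :=
    ObjectProperty.trW.mk P (triangleOfSES_distinguished h₂) hcoker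
  have w₃ : P.trW (Q.map (Abelian.coimageImageComparison φ)) := P.trW_of_isIso _
  -- `φ` is an epimorphism with kernel `kernel φ`, then an isomorphism, then a monomorphism with
  -- cokernel `cokernel φ`.
  rw [← Abelian.coimage_image_factorisation φ, Q.map_comp, Q.map_comp]
  exact P.trW.comp_mem _ _ w₁ (P.trW.comp_mem _ _ w₃ w₂)

variable (X Y : ObjectProperty A) [IsAbelianSubcategory X] [IsAbelianSubcategory Y]
  (L : A ⥤ A) [L.Additive] (η : 𝟭 A ⟶ L)

theorem exists_triangle_of_reflection [(mapDb X.ι).Full]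
    (hL : ∀ M, Y (L.obj M)) (hker : ∀ M, X (kernel (η.app M)))
    (hcoker : ∀ M, X (cokernel (η.app M))) (M : Db A) :
    ∃ (K : Db X.FullSubcategory) (N : Db Y.FullSubcategory)
    (f : (mapDb X.ι).obj K ⟶ M) (g : M ⟶ (mapDb Y.ι).obj N)
    (h : (mapDb Y.ι).obj N ⟶ ((mapDb X.ι).obj K)⟦(1 : ℤ)⟧),
    Triangle.mk f g h ∈ distTriang (Db A) := by
  obtain ⟨⟨a, ha⟩, ⟨b, hb⟩⟩ := M.property
  obtain ⟨K, hKa, hKb, ⟨e⟩⟩ := exists_iso_Q_obj_of_isGE_of_isLE M.obj a b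
  let LK : CochainComplex A ℤ := (L.mapHomologicalComplex (ComplexShape.up ℤ)).obj K
  let φ : K ⟶ LK :=
    { f := fun i => η.app (K.X i)
      comm' := fun i j _ => (η.naturality (K.d i j)).symm }
  have := isClosedUnderIsomorphisms_of_isClosedUnderKernels X
  have hkX : ∀ n, X ((kernel φ).X n) := fun n => X.prop_of_iso
    (PreservesKernel.iso (HomologicalComplex.eval A (ComplexShape.up ℤ) n) φ).symm (hker (K.X n))
  have hcX : ∀ n, X ((cokernel φ).X n) := fun n => X.prop_of_iso
    (PreservesCokernel.iso (HomologicalComplex.eval A (ComplexShape.up ℤ) n) φ).symm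
    (hcoker (K.X n))
  -- An additive functor preserves zero objects, so the bounds of `K` carry over.
  have : LK.IsStrictlyGE a := inferInstance
  have : LK.IsStrictlyLE b := inferInstance
  have : (kernel φ).IsStrictlyGE a := isStrictlyGE_of_mono (kernel.ι φ) a
  have : (kernel φ).IsStrictlyLE b := isStrictlyLE_of_mono (kernel.ι φ) b
  have : (cokernel φ).IsStrictlyGE a := isStrictlyGE_of_epi (cokernel.π φ) a
  have : (cokernel φ).IsStrictlyLE b := isStrictlyLE_of_epi (cokernel.π φ) b
  let F := mapDb X.ι ⋙ (t (C := A)).bounded.ι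
  have hker' : F.essImage (Q.obj (kernel φ)) := exists_mapDb_iso X _ a b hkX
  have hcoker' : F.essImage (Q.obj (cokernel φ)) := exists_mapDb_iso X _ a b hcX
  obtain ⟨N, ⟨eN⟩⟩ := exists_mapDb_iso Y LK a b (fun n => hL _)
  -- Fullness of `mapDb X.ι` makes this essential image a triangulated subcategory.
  have hQ : F.essImage.trW (Q.map φ) := trW_Q_map F.essImage φ hker' hcoker'
  let g : M ⟶ (mapDb Y.ι).obj N := ObjectProperty.homMk (e.hom ≫ Q.map φ ≫ eN.inv)
  have hg : F.essImage.trW ((t (C := A)).bounded.ι.map g) :=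
    (F.essImage.trW.arrow_mk_iso_iff (Arrow.isoMk (f := Arrow.mk ((t (C := A)).bounded.ι.map g))
      (g := Arrow.mk (Q.map φ)) e eN (by simp [g]))).2 hQ
  obtain ⟨Z, f, h, hT⟩ := distinguished_cocone_triangle₁ g
  have hZ := (F.essImage.trW_iff_of_distinguished' _
    ((t (C := A)).bounded.ι.map_distinguished _ hT)).1 hg
  obtain ⟨K₀, ⟨e₀⟩⟩ := hZ
  let isoZ : (mapDb X.ι).obj K₀ ≅ Z := (t (C := A)).bounded.ι.preimageIso e₀
  refine ⟨K₀, N, isoZ.hom ≫ f, g, h ≫ isoZ.inv⟦1⟧', distinguished_of_iso_obj₁ hT isoZ⟩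

/-- Criterion for a derived decomposition `(X, Y)`: both subcategories embed in injective
objects, there are no nonzero maps from `X` to `Y`, and each object maps functorially to an
object of `Y` with kernel and cokernel in `X`. -/
theorem isDerivedDecomposition_of_reflection
    (hX : ∀ M, X M → ∃ (J : A) (i : M ⟶ J), X J ∧ Injective J ∧ Mono i)
    (hY : ∀ M, Y M → Injective M) (hXY : ∀ M N, X M → Y N → ∀ f : M ⟶ N, f = 0)
    (hL : ∀ M, Y (L.obj M)) (hker : ∀ M, X (kernel (η.app M)))
    (hcoker : ∀ M, X (cokernel (η.app M))) : IsDerivedDecomposition X Y := by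
  have hY' : ∀ M, Y M → ∃ (J : A) (i : M ⟶ J), Y J ∧ Injective J ∧ Mono i :=
    fun M hM => ⟨M, 𝟙 M, hM, hY M hM, inferInstance⟩
  have := enoughInjectives_fullSubcategory X hX
  have := preservesInjectiveObjects_ι X hX
  have := enoughInjectives_fullSubcategory Y hY'
  have := preservesInjectiveObjects_ι Y hY'
  have := mapDb_full X.ι
  exact
    { isAbelianSubcategory_left := inferInstance
      isAbelianSubcategory_right := inferInstance
      full_left := inferInstance
      faithful_left := mapDb_faithful X.ι
      full_right := mapDb_full Y.ι
      faithful_right := mapDb_faithful Y.ι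
      hom_eq_zero := fun M N hM hN n f =>
        have := hY N hN
        stalk_hom_shift_eq_zero M N (hXY M N hM hN) n f
      exists_triangle := exists_triangle_of_reflection X Y L η hL hker hcoker }

end Triangles

end DerivedDecomposition

namespace SingularModules

open Limits

/-! ### Singular and nonsingular modules -/

section Basic

universe w

variable {R : Type u} [Ring R] {M : Type v} [AddCommGroup M] [Module R M]
  {N : Type w} [AddCommGroup N] [Module R N]

theorem IsEssential.comap {K : Submodule R N} (hK : IsEssential K) (f : M →ₗ[R] N) :
    IsEssential (K.comap f) := by
  rw [isEssential_iff] at hK ⊢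
  intro x hx
  by_cases h : f x = 0
  · exact ⟨1, by simp [h], by simpa using hx⟩
  · obtain ⟨r, hr, hr0⟩ := hK (f x) h
    exact ⟨r, by simpa using hr, fun h0 => hr0 (by rw [← map_smul, h0, map_zero])⟩

theorem isSingular_iff : IsSingular R M ↔ ∀ x : M, x ∈ singularSubmodule R M :=
  Submodule.eq_top_iff'

theorem isNonsingular_iff :
    IsNonsingular R M ↔ ∀ x ∈ singularSubmodule R M, x = 0 :=
  Submodule.eq_bot_iff _

theorem map_mem_singularSubmodule (f : M →ₗ[R] N) {x : M} (hx : x ∈ singularSubmodule R M) :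
    f x ∈ singularSubmodule R N := by
  obtain ⟨I, hI, h⟩ := hx
  exact ⟨I, hI, fun r hr => by rw [← map_smul, h r hr, map_zero]⟩

theorem mem_singularSubmodule_of_injective {f : M →ₗ[R] N} (hf : Function.Injective f) {x : M}
    (hx : f x ∈ singularSubmodule R N) : x ∈ singularSubmodule R M := by
  obtain ⟨I, hI, h⟩ := hx
  exact ⟨I, hI, fun r hr => hf (by rw [map_smul, h r hr, map_zero])⟩

theorem IsSingular.of_injective (hN : IsSingular R N) {f : M →ₗ[R] N}
    (hf : Function.Injective f) : IsSingular R M :=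
  isSingular_iff.2 fun x => mem_singularSubmodule_of_injective hf (isSingular_iff.1 hN (f x))

theorem IsSingular.of_surjective (hM : IsSingular R M) {f : M →ₗ[R] N}
    (hf : Function.Surjective f) : IsSingular R N := by
  rw [isSingular_iff] at hM ⊢
  intro y
  obtain ⟨x, rfl⟩ := hf y
  exact map_mem_singularSubmodule f (hM x)

theorem IsSingular.prod (hM : IsSingular R M) (hN : IsSingular R N) : IsSingular R (M × N) :=
  isSingular_iff.2 fun x => by
    have h := add_mem (map_mem_singularSubmodule (LinearMap.inl R M N) (isSingular_iff.1 hM x.1))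
      (map_mem_singularSubmodule (LinearMap.inr R M N) (isSingular_iff.1 hN x.2))
    simpa using h

theorem isSingular_singularSubmodule : IsSingular R (singularSubmodule R M) :=
  isSingular_iff.2 fun x => mem_singularSubmodule_of_injective
    (f := (singularSubmodule R M).subtype) (Submodule.subtype_injective _) x.2

/-- The class of $x$ is killed by $\{r : rx\in K\}$, the preimage of an essential submodule. -/
theorem IsEssential.isSingular_quotient {K : Submodule R M} (hK : IsEssential K) :
    IsSingular R (M ⧸ K) := by
  rw [isSingular_iff]
  intro y
  obtain ⟨x, rfl⟩ := K.mkQ_surjective y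
  refine ⟨_, hK.comap (LinearMap.toSpanSingleton R M x), fun r hr => ?_⟩
  rw [← map_smul]
  exact (Submodule.Quotient.mk_eq_zero K).2 (by simpa using hr)

theorem IsNonsingular.of_injective (hN : IsNonsingular R N) {f : M →ₗ[R] N}
    (hf : Function.Injective f) : IsNonsingular R M :=
  isNonsingular_iff.2 fun x hx =>
    hf (by rw [isNonsingular_iff.1 hN _ (map_mem_singularSubmodule f hx), map_zero])

theorem IsNonsingular.pi {ι : Type*} {M : ι → Type*} [∀ i, AddCommGroup (M i)]
    [∀ i, Module R (M i)] (hM : ∀ i, IsNonsingular R (M i)) : IsNonsingular R (∀ i, M i) :=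
  isNonsingular_iff.2 fun _ hx => funext fun i =>
    isNonsingular_iff.1 (hM i) _ (map_mem_singularSubmodule (LinearMap.proj i) hx)

theorem IsNonsingular.prod (hM : IsNonsingular R M) (hN : IsNonsingular R N) :
    IsNonsingular R (M × N) :=
  isNonsingular_iff.2 fun _ hx => Prod.ext
    (isNonsingular_iff.1 hM _ (map_mem_singularSubmodule (LinearMap.fst R M N) hx))
    (isNonsingular_iff.1 hN _ (map_mem_singularSubmodule (LinearMap.snd R M N) hx))

/-- $Z(M)\cap K=Z(K)=0$, so essentiality of $K$ forces $Z(M)=0$. -/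
theorem IsNonsingular.of_isEssential {K : Submodule R M} (hK : IsEssential K)
    (h : IsNonsingular R K) : IsNonsingular R M := by
  refine by_contra fun hZ => hK _ hZ ?_
  rw [Submodule.eq_bot_iff]
  rintro x ⟨hxK, hxZ⟩
  have := isNonsingular_iff.1 h ⟨x, hxK⟩
    (mem_singularSubmodule_of_injective (f := K.subtype) K.subtype_injective hxZ)
  exact congrArg Subtype.val this

theorem IsSingular.linearMap_eq_zero (hM : IsSingular R M) (hN : IsNonsingular R N)
    (f : M →ₗ[R] N) : f = 0 :=
  LinearMap.ext fun x =>
    isNonsingular_iff.1 hN _ (map_mem_singularSubmodule f (isSingular_iff.1 hM x))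

/-- Over a left nonsingular ring, singular elements may be detected modulo singular elements. -/
theorem mem_singularSubmodule_of_smul_mem (hR : IsLeftNonsingularRing R) {x : M}
    {I : Submodule R R} (hI : IsEssential I)
    (hx : ∀ r ∈ I, r • x ∈ singularSubmodule R M) : x ∈ singularSubmodule R M := by
  refine ⟨LinearMap.ker (LinearMap.toSpanSingleton R M x), ?_, fun r hr => by simpa using hr⟩
  rw [isEssential_iff] at hI ⊢
  intro s hs
  obtain ⟨a, ha, ha0⟩ := hI s hs
  obtain ⟨J, hJ, hJx⟩ := hx _ ha
  -- Otherwise the essential left ideal `J` would kill the nonzero element `a • s` of the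
  -- nonsingular module $R$.
  obtain ⟨j, hj, hj0⟩ : ∃ j ∈ J, j • a • s ≠ 0 := by
    by_contra! h
    exact ha0 (isNonsingular_iff.1 hR _ ⟨J, hJ, h⟩)
  exact ⟨j * a, by simpa [mul_smul, mul_assoc] using hJx j hj, by rwa [mul_smul]⟩

theorem isNonsingular_quotient_singularSubmodule (hR : IsLeftNonsingularRing R) :
    IsNonsingular R (M ⧸ singularSubmodule R M) := by
  rw [isNonsingular_iff]
  intro y hy
  obtain ⟨x, rfl⟩ := (singularSubmodule R M).mkQ_surjective y
  obtain ⟨I, hI, h⟩ := hy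
  refine (Submodule.Quotient.mk_eq_zero _).2 (mem_singularSubmodule_of_smul_mem hR hI ?_)
  intro r hr
  exact (Submodule.Quotient.mk_eq_zero _).1 (by simpa using h r hr)

/-- The essential left ideal $\{r : rx\in K\}$ moves $x$ into $K\subseteq Z(M)$. -/
theorem IsSingular.of_isEssential (hR : IsLeftNonsingularRing R) {K : Submodule R M}
    (hK : IsEssential K) (h : IsSingular R K) : IsSingular R M := by
  rw [isSingular_iff]
  intro x
  refine mem_singularSubmodule_of_smul_mem hR (hK.comap (LinearMap.toSpanSingleton R M x))
    fun r hr => ?_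
  exact map_mem_singularSubmodule K.subtype (isSingular_iff.1 h ⟨r • x, by simpa using hr⟩)

end Basic

/-! ### Injective envelopes and nonsingular injectives -/

section Envelope

variable {R : Type u} [Ring R] {M N : Type u} [AddCommGroup M] [Module R M]
  [AddCommGroup N] [Module R N]

theorem injective_of_leftInverse [Module.Injective R N] (i : M →ₗ[R] N) (p : N →ₗ[R] M)
    (h : Function.LeftInverse p i) : Module.Injective R M where
  out X Y _ _ _ _ f hf g := by
    obtain ⟨k, hk⟩ := Module.Injective.out f hf (i ∘ₗ g)
    exact ⟨p ∘ₗ k, fun x => (congrArg p (hk x)).trans (h (g x))⟩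

theorem injective_prod [Module.Injective R M] [Module.Injective R N] :
    Module.Injective R (M × N) where
  out X Y _ _ _ _ f hf g := by
    obtain ⟨k, hk⟩ := Module.Injective.out f hf (LinearMap.fst R M N ∘ₗ g)
    obtain ⟨l, hl⟩ := Module.Injective.out f hf (LinearMap.snd R M N ∘ₗ g)
    exact ⟨k.prod l, fun x => Prod.ext (hk x) (hl x)⟩

theorem IsInjectiveEnvelope.isNonsingular {f : M →ₗ[R] N} (hf : IsInjectiveEnvelope f)
    (hM : IsNonsingular R M) : IsNonsingular R N :=
  .of_isEssential hf.essential_range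
    (hM.of_injective (LinearEquiv.ofInjective f hf.injective_map).symm.injective)

theorem IsInjectiveEnvelope.isSingular (hR : IsLeftNonsingularRing R) {f : M →ₗ[R] N}
    (hf : IsInjectiveEnvelope f) (hM : IsSingular R M) : IsSingular R N :=
  .of_isEssential hR hf.essential_range (hM.of_surjective f.surjective_rangeRestrict)

/-- A submodule of an injective module with nonsingular quotient is injective. -/
theorem injective_of_isNonsingular_quotient [Module.Injective R M] (K : Submodule R M)
    (hK : IsNonsingular R (M ⧸ K)) : Module.Injective R K := by
  have hE := isInjectiveEnvelope_toInjectiveEnvelope R K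
  have := hE.injective_module
  obtain ⟨g, hg⟩ := Module.Injective.out (toInjectiveEnvelope R K) hE.injective_map K.subtype
  -- Modulo `K`, the element `g e` is killed by the essential left ideal of those `r` with `r • e`
  -- in the image of `K`, so it vanishes in the nonsingular quotient.
  have hgK : ∀ e, g e ∈ K := fun e => by
    refine (Submodule.Quotient.mk_eq_zero K).1 (isNonsingular_iff.1 hK _
      ⟨_, hE.essential_range.comap (LinearMap.toSpanSingleton R _ e), fun r hr => ?_⟩)
    obtain ⟨k, hk⟩ : ∃ k, toInjectiveEnvelope R K k = r • e := by simpa using hr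
    rw [← Submodule.Quotient.mk_smul, Submodule.Quotient.mk_eq_zero, ← map_smul, ← hk, hg]
    exact k.2
  exact injective_of_leftInverse (toInjectiveEnvelope R K) (g.codRestrict K hgK)
    (fun k => Subtype.ext (hg k))

/-- The quotient by an injective submodule splits. -/
theorem exists_rightInverse_mkQ (K : Submodule R M) [Module.Injective R K] :
    ∃ s : (M ⧸ K) →ₗ[R] M, Function.LeftInverse K.mkQ s := by
  obtain ⟨p, hp⟩ := Module.Injective.out K.subtype K.subtype_injective LinearMap.id
  -- With `p` a retraction onto `K`, the map `id - p` kills `K` and descends to a section.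
  refine ⟨K.liftQ (LinearMap.id - K.subtype ∘ₗ p) fun x hx => ?_, fun y => ?_⟩
  · have := congrArg Subtype.val (hp ⟨x, hx⟩)
    simpa [sub_eq_zero] using this.symm
  · obtain ⟨x, rfl⟩ := K.mkQ_surjective y
    simp

theorem injective_quotient [Module.Injective R M] (K : Submodule R M) [Module.Injective R K] :
    Module.Injective R (M ⧸ K) :=
  let ⟨s, hs⟩ := exists_rightInverse_mkQ K
  injective_of_leftInverse s K.mkQ hs

theorem IsNonsingular.quotient_of_injective (hM : IsNonsingular R M) (K : Submodule R M)
    [Module.Injective R K] : IsNonsingular R (M ⧸ K) :=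
  let ⟨_, hs⟩ := exists_rightInverse_mkQ K
  hM.of_injective hs.injective

/-- Nonsingular modules are cogenerated by the injective envelope of the ring. -/
theorem exists_linearMap_injectiveEnvelope_ne_zero (hM : IsNonsingular R M) {x : M}
    (hx : x ≠ 0) : ∃ f : M →ₗ[R] injectiveEnvelope R R, f x ≠ 0 := by
  have hE := isInjectiveEnvelope_toInjectiveEnvelope R R
  let φ := LinearMap.toSpanSingleton R M x
  -- The annihilator of `x` is not essential, so some nonzero left ideal `J` meets it trivially.
  -- Then `J` embeds in `M` by $j\mapsto jx$, and its inclusion in $E(R)$ extends to `M`.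
  obtain ⟨J, hJ, hJx⟩ : ∃ J : Submodule R R, J ≠ ⊥ ∧ LinearMap.ker φ ⊓ J = ⊥ := by
    have : ¬ IsEssential (LinearMap.ker φ) := fun h =>
      hx (isNonsingular_iff.1 hM x ⟨_, h, fun r hr => by simpa [φ] using hr⟩)
    simpa [IsEssential] using this
  obtain ⟨j, hj, hj0⟩ := Submodule.exists_mem_ne_zero_of_ne_bot hJ
  have hinj : Function.Injective (φ ∘ₗ J.subtype) := by
    rw [← LinearMap.ker_eq_bot, LinearMap.ker_eq_bot']
    intro y hy
    have : (y : R) ∈ LinearMap.ker φ ⊓ J := ⟨hy, y.2⟩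
    rw [hJx] at this
    exact Subtype.ext this
  obtain ⟨g, hg⟩ := hE.injective_module.out (φ ∘ₗ J.subtype) hinj
    (toInjectiveEnvelope R R ∘ₗ J.subtype)
  refine ⟨g, fun h => hj0 (hE.injective_map ?_)⟩
  have := hg ⟨j, hj⟩
  simp only [φ, LinearMap.comp_apply, Submodule.subtype_apply,
    LinearMap.toSpanSingleton_apply, map_smul, h, smul_zero] at this
  rw [← this, map_zero]

/-- Over a left nonsingular ring, the summands of powers of the injective envelope of the ring
are the nonsingular injective modules. -/
theorem summandsOfPowers_iff (hR : IsLeftNonsingularRing R) (M : ModuleCat.{u} R) :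
    summandsOfPowers (injectiveEnvelope R R) M ↔ Module.Injective R M ∧ IsNonsingular R M := by
  have hE := isInjectiveEnvelope_toInjectiveEnvelope R R
  have := hE.injective_module
  constructor
  · rintro ⟨I, N, ⟨e⟩⟩
    let i : M →ₗ[R] (I → injectiveEnvelope R R) := e.toLinearMap ∘ₗ LinearMap.inl R M N
    let p : (I → injectiveEnvelope R R) →ₗ[R] M := LinearMap.fst R M N ∘ₗ e.symm.toLinearMap
    have h : Function.LeftInverse p i := fun x => by simp [i, p]
    exact ⟨injective_of_leftInverse i p h,
      (IsNonsingular.pi fun _ => hE.isNonsingular hR).of_injective h.injective⟩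
  · rintro ⟨hM, hM'⟩
    -- Use one factor for each map from `M` to $E(R)$; cogeneration makes this an embedding, and
    -- injectivity of `M` splits it.
    let i : M →ₗ[R] ((M →ₗ[R] injectiveEnvelope R R) → injectiveEnvelope R R) :=
      LinearMap.pi fun f => f
    have hi : Function.Injective i := by
      rw [← LinearMap.ker_eq_bot, LinearMap.ker_eq_bot']
      intro x hx
      by_contra hx0
      obtain ⟨f, hf⟩ := exists_linearMap_injectiveEnvelope_ne_zero hM' hx0
      exact hf (congrFun hx f)
    obtain ⟨p, hp⟩ := hM.out i hi LinearMap.id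
    have hc := LinearMap.isCompl_of_proj
      (p := LinearMap.range i) (f := i.rangeRestrict ∘ₗ p) (by
        rintro ⟨_, x, rfl⟩
        exact Subtype.ext (congrArg i (hp x)))
    exact ⟨M →ₗ[R] injectiveEnvelope R R, ModuleCat.of R (LinearMap.ker (i.rangeRestrict ∘ₗ p)),
      ⟨((LinearEquiv.ofInjective i hi).prodCongr (LinearEquiv.refl R _)).trans
        (Submodule.prodEquivOfIsCompl _ _ hc)⟩⟩

end Envelope

end SingularModules

namespace SingularModules

open Limits DerivedDecomposition

/-! ### The two subcategories and the localization functor -/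

section Categorical

variable {R : Type u} [Ring R]

theorem isClosedUnderFiniteProducts_of_prod (P : ObjectProperty (ModuleCat.{u} R))
    [P.ContainsZero] [P.IsClosedUnderIsomorphisms]
    (h : ∀ M N, P M → P N → P (ModuleCat.of R (M × N))) : P.IsClosedUnderFiniteProducts := by
  have : P.IsClosedUnderBinaryProducts :=
    { limitsOfShape_le := by
        rintro X ⟨p⟩
        refine P.prop_of_iso ?_ (h _ _ (p.prop_diag_obj (.mk .left)) (p.prop_diag_obj (.mk .right)))
        exact IsLimit.conePointUniqueUpToIso (ModuleCat.binaryProductLimitCone _ _).isLimit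
          ((IsLimit.postcomposeHomEquiv (diagramIsoPair p.diag) _).2 p.isLimit) }
  exact .mk'

instance : (singularModules R).IsClosedUnderSubobjects where
  prop_of_mono f _ hN :=
    IsSingular.of_injective hN ((ModuleCat.mono_iff_injective f).1 inferInstance)

instance : (singularModules R).IsClosedUnderQuotients where
  prop_of_epi f _ hM :=
    IsSingular.of_surjective hM ((ModuleCat.epi_iff_surjective f).1 inferInstance)

instance : (singularModules R).ContainsZero where
  exists_zero := ⟨ModuleCat.of R PUnit, ModuleCat.isZero_of_subsingleton _,
    isSingular_iff.2 fun x => by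
      rw [Subsingleton.elim x 0]
      exact zero_mem _⟩

instance : IsAbelianSubcategory (singularModules R) where
  toIsClosedUnderFiniteProducts :=
    isClosedUnderFiniteProducts_of_prod _ fun _ _ hM hN => IsSingular.prod hM hN

/-- For $f:M\to N$, the quotient $M/\ker f$ embeds in the nonsingular $N$, so $\ker f$ is injective.
Then $M/\ker f\cong\operatorname{im} f$ is injective too, and $\operatorname{coker} f$ is a summand
of $N$. -/
theorem isAbelianSubcategory_summandsOfPowers (hR : IsLeftNonsingularRing R) :
    IsAbelianSubcategory (summandsOfPowers (injectiveEnvelope R R)) := by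
  have : (summandsOfPowers (injectiveEnvelope R R)).IsClosedUnderIsomorphisms :=
    ⟨fun {M N} e ⟨I, K, ⟨f⟩⟩ =>
      ⟨I, K, ⟨(e.symm.toLinearEquiv.prodCongr (LinearEquiv.refl R K)).trans f⟩⟩⟩
  have : (summandsOfPowers (injectiveEnvelope R R)).ContainsZero :=
    ⟨ModuleCat.of R PUnit, ModuleCat.isZero_of_subsingleton _,
      PEmpty, ModuleCat.of R PUnit, ⟨LinearEquiv.ofSubsingleton _ _⟩⟩
  have hker : ∀ {M N : ModuleCat.{u} R} (f : M ⟶ N),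
      summandsOfPowers (injectiveEnvelope R R) M → summandsOfPowers (injectiveEnvelope R R) N →
        Module.Injective R (LinearMap.ker f.hom) := fun {M N} f hM hN => by
    rw [summandsOfPowers_iff hR] at hM hN
    have := hM.1
    exact injective_of_isNonsingular_quotient _
      (hN.2.of_injective
        (f := (LinearMap.range f.hom).subtype ∘ₗ f.hom.quotKerEquivRange.toLinearMap)
        (Subtype.val_injective.comp f.hom.quotKerEquivRange.injective))
  have hclosedKer : (summandsOfPowers (injectiveEnvelope R R)).IsClosedUnderKernels := by
    refine ⟨?_⟩
    rintro _ ⟨f, k, hk, hf⟩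
    refine ObjectProperty.prop_of_iso _
      (IsLimit.conePointUniqueUpToIso (ModuleCat.kernelIsLimit f) hk) ?_
    exact (summandsOfPowers_iff hR _).2 ⟨hker f hf.1 hf.2,
      ((summandsOfPowers_iff hR _).1 hf.1).2.of_injective (Submodule.subtype_injective _)⟩
  have hclosedCoker : (summandsOfPowers (injectiveEnvelope R R)).IsClosedUnderCokernels := by
    refine ⟨?_⟩
    rintro _ ⟨f, k, hk, hf⟩
    refine ObjectProperty.prop_of_iso _
      (IsColimit.coconePointUniqueUpToIso (ModuleCat.cokernelIsColimit f) hk) ?_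
    have hN := (summandsOfPowers_iff hR _).1 hf.2
    have := hN.1
    have := ((summandsOfPowers_iff hR _).1 hf.1).1
    have := hker f hf.1 hf.2
    have := injective_quotient (LinearMap.ker f.hom)
    have : Module.Injective R (LinearMap.range f.hom) :=
      injective_of_leftInverse f.hom.quotKerEquivRange.symm.toLinearMap
        f.hom.quotKerEquivRange.toLinearMap f.hom.quotKerEquivRange.apply_symm_apply
    exact (summandsOfPowers_iff hR _).2
      ⟨injective_quotient (LinearMap.range f.hom), hN.2.quotient_of_injective _⟩
  have hprod := isClosedUnderFiniteProducts_of_prod (summandsOfPowers (injectiveEnvelope R R))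
    fun M N hM hN => by
      rw [summandsOfPowers_iff hR] at hM hN ⊢
      have := hM.1
      have := hN.1
      exact ⟨injective_prod, hM.2.prod hN.2⟩
  exact { }

/-- The morphism from `M` to the injective envelope of `M / Z(M)`. -/
noncomputable def toLocalization (M : ModuleCat.{u} R) :
    M ⟶ ModuleCat.of R (injectiveEnvelope R (M ⧸ singularSubmodule R M)) :=
  ModuleCat.ofHom (toInjectiveEnvelope R _ ∘ₗ (singularSubmodule R M).mkQ)

theorem ker_toLocalization (M : ModuleCat.{u} R) :
    LinearMap.ker (toLocalization M).hom = singularSubmodule R M := by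
  rw [toLocalization, ModuleCat.hom_ofHom, LinearMap.ker_comp_of_ker_eq_bot,
    Submodule.ker_mkQ]
  exact LinearMap.ker_eq_bot.2 (isInjectiveEnvelope_toInjectiveEnvelope R _).injective_map

theorem range_toLocalization (M : ModuleCat.{u} R) :
    LinearMap.range (toLocalization M).hom = LinearMap.range (toInjectiveEnvelope R _) := by
  rw [toLocalization, ModuleCat.hom_ofHom, LinearMap.range_comp_of_range_eq_top]
  exact Submodule.range_mkQ _

theorem singularModules_kernel_toLocalization (M : ModuleCat.{u} R) :
    singularModules R (kernel (toLocalization M)) :=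
  (singularModules R).prop_of_iso (ModuleCat.kernelIsoKer _).symm (by
    change IsSingular R (LinearMap.ker (toLocalization M).hom)
    rw [ker_toLocalization]
    exact isSingular_singularSubmodule)

theorem singularModules_cokernel_toLocalization (M : ModuleCat.{u} R) :
    singularModules R (cokernel (toLocalization M)) :=
  (singularModules R).prop_of_iso (ModuleCat.cokernelIsoRangeQuotient _).symm (by
    change IsSingular R (_ ⧸ LinearMap.range (toLocalization M).hom)
    rw [range_toLocalization]
    exact (isInjectiveEnvelope_toInjectiveEnvelope R _).essential_range.isSingular_quotient)

theorem isNonsingular_localization (hR : IsLeftNonsingularRing R) (M : ModuleCat.{u} R) :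
    IsNonsingular R (injectiveEnvelope R (M ⧸ singularSubmodule R M)) :=
  (isInjectiveEnvelope_toInjectiveEnvelope R _).isNonsingular
    (isNonsingular_quotient_singularSubmodule hR)

/-- The two maps agree on an essential submodule, so their difference takes values in $Z(N)=0$. -/
theorem toLocalization_hom_ext {M N : ModuleCat.{u} R} (hN : IsNonsingular R N)
    {f g : ModuleCat.of R (injectiveEnvelope R (M ⧸ singularSubmodule R M)) ⟶ N}
    (h : toLocalization M ≫ f = toLocalization M ≫ g) : f = g := by
  refine ModuleCat.hom_ext (LinearMap.ext fun e => sub_eq_zero.1 (isNonsingular_iff.1 hN _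
    ⟨_, (isInjectiveEnvelope_toInjectiveEnvelope R _).essential_range.comap
      (LinearMap.toSpanSingleton R _ e), fun r hr => ?_⟩))
  have hmem : r • e ∈ LinearMap.range (toLocalization M).hom := by
    rw [range_toLocalization]
    simpa using hr
  obtain ⟨x, hx⟩ := hmem
  rw [smul_sub, ← map_smul, ← map_smul, ← hx, sub_eq_zero]
  exact congrArg (fun k => k.hom x) h

/-- A map to a nonsingular module kills $Z(M)$; the induced map on $M/Z(M)$ extends to the envelope
by injectivity of $N$. -/
theorem exists_toLocalization_comp_eq {M N : ModuleCat.{u} R} [Module.Injective R N]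
    (hN : IsNonsingular R N) (f : M ⟶ N) :
    ∃ g : ModuleCat.of R (injectiveEnvelope R (M ⧸ singularSubmodule R M)) ⟶ N,
      toLocalization M ≫ g = f := by
  obtain ⟨g, hg⟩ := Module.Injective.out (toInjectiveEnvelope R (M ⧸ singularSubmodule R M))
    (isInjectiveEnvelope_toInjectiveEnvelope R _).injective_map
    ((singularSubmodule R M).liftQ f.hom fun x hx =>
      isNonsingular_iff.1 hN _ (map_mem_singularSubmodule f.hom hx))
  exact ⟨ModuleCat.ofHom g, ModuleCat.hom_ext (LinearMap.ext fun x => hg _)⟩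

/-- Over a left nonsingular ring, `M ↦ E(M / Z(M))` is a functor. -/
noncomputable def localization (hR : IsLeftNonsingularRing R) :
    ModuleCat.{u} R ⥤ ModuleCat.{u} R :=
  have hinj (M : ModuleCat.{u} R) :=
    (isInjectiveEnvelope_toInjectiveEnvelope R (M ⧸ singularSubmodule R M)).injective_module
  have hex {M N : ModuleCat.{u} R} (f : M ⟶ N) :=
    have := hinj N
    exists_toLocalization_comp_eq (isNonsingular_localization hR N) (f ≫ toLocalization N)
  { obj M := ModuleCat.of R (injectiveEnvelope R (M ⧸ singularSubmodule R M))
    map f := (hex f).choose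
    map_id M := toLocalization_hom_ext (isNonsingular_localization hR M) (by
      rw [(hex (𝟙 M)).choose_spec, Category.id_comp, Category.comp_id])
    map_comp {M N K} f g := toLocalization_hom_ext (isNonsingular_localization hR K) (by
      rw [(hex (f ≫ g)).choose_spec, reassoc_of% (hex f).choose_spec, (hex g).choose_spec,
        Category.assoc]) }

/-- The natural transformation `M ⟶ E(M / Z(M))`. -/
noncomputable def localizationUnit (hR : IsLeftNonsingularRing R) :
    𝟭 (ModuleCat.{u} R) ⟶ localization hR where
  app := toLocalization
  naturality M N f := by
    have hinj :=
      (isInjectiveEnvelope_toInjectiveEnvelope R (N ⧸ singularSubmodule R N)).injective_module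
    exact (exists_toLocalization_comp_eq (isNonsingular_localization hR N)
      (f ≫ toLocalization N)).choose_spec.symm

instance (hR : IsLeftNonsingularRing R) : (localization hR).Additive where
  -- By uniqueness of extensions it suffices to compare after the unit, where naturality gives
  -- additivity.
  map_add {_ N f g} := toLocalization_hom_ext (isNonsingular_localization hR N)
    (((localizationUnit hR).naturality (f + g)).symm.trans ((Preadditive.add_comp _ _ _ f g _).trans
      ((congrArg₂ (· + ·) ((localizationUnit hR).naturality f)
        ((localizationUnit hR).naturality g)).trans (Preadditive.comp_add _ _ _ _ _ _).symm)))

end Categorical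

end SingularModules

theorem corollary4p10 (R : Type u) [Ring R] (hR : SingularModules.IsLeftNonsingularRing R) :
    DerivedDecomposition.IsDerivedDecomposition (A := ModuleCat.{u} R)
      (SingularModules.singularModules R)
      (SingularModules.summandsOfPowers (SingularModules.injectiveEnvelope R R)) := by
  have := SingularModules.isAbelianSubcategory_summandsOfPowers hR
  refine DerivedDecomposition.isDerivedDecomposition_of_reflection _ _
    (SingularModules.localization hR) (SingularModules.localizationUnit hR) ?_ ?_ ?_ ?_
    SingularModules.singularModules_kernel_toLocalization
    SingularModules.singularModules_cokernel_toLocalization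
  · intro M hM
    have hE := SingularModules.isInjectiveEnvelope_toInjectiveEnvelope R M
    exact ⟨_, ModuleCat.ofHom (SingularModules.toInjectiveEnvelope R M), hE.isSingular hR hM,
      (Module.injective_iff_injective_object R _).1 hE.injective_module,
      (ModuleCat.mono_iff_injective _).2 hE.injective_map⟩
  · exact fun M hM => (Module.injective_iff_injective_object R M).1
      ((SingularModules.summandsOfPowers_iff hR M).1 hM).1
  · exact fun M N hM hN f => ModuleCat.hom_ext (SingularModules.IsSingular.linearMap_eq_zero hM
      ((SingularModules.summandsOfPowers_iff hR N).1 hN).2 f.hom)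
  · exact fun M => (SingularModules.summandsOfPowers_iff hR _).2
      ⟨(SingularModules.isInjectiveEnvelope_toInjectiveEnvelope R _).injective_module,
        SingularModules.isNonsingular_localization hR M⟩
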